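/- Let $\mathbb H=\{z=x+iy\in\mathbb C: y>0\}$ and let $k$ be an integer. For a smooth function $f:\mathbb H\to\mathbb C$ (i.e. $C^\infty$ in the real variables $x,y$) put $$\frac{\partial f}{\partial\bar z}=\frac12\left(\frac{\partial f}{\partial x}+i\frac{\partial f}{\partial y}\right),\qquad \xi_k f=2i\,y^k\,\overline{\frac{\partial f}{\partial\bar z}},$$ $$\Delta_k f=y^2\left(\frac{\partial^2 f}{\partial x^2}+\frac{\partial^2 f}{\partial y^2}\right)-iky\left(\frac{\partial f}{\partial x}+i\frac{\partial f}{\partial y}\right).$$ A smooth (not necessarily holomorphic) modular form of weight $k$ for $\mathrm{SL}_2(\mathbb Z)$ is a smooth function $f:\mathbb H\to\mathbb C$ such that $f\left(\frac{az+b}{cz+d}\right)=(cz+d)^kf(z)$ for all $z\in\mathbb H$ and all $\begin{pmatrix}a&b\\c&d\end{pmatrix}\in\mathrm{SL}_2(\mathbb Z)$; it has polynomial (moderate) growth if there is $\alpha\in\mathbb R$ with $f(x+iy)=O(y^\alpha)$ as $y\to\infty$, uniformly in $x\in\mathbb R$. Let $V_k^1(0)$ be the space of smooth modular forms $f$ of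 weight $k$ for $\mathrm{SL}_2(\mathbb Z)$ that have polynomial growth and satisfy $\Delta_kf=0$. **Proposition.** Let $g$ be a nonzero holomorphic cusp form of weight $k$ for $\mathrm{SL}_2(\mathbb Z)$. 1. If $M$ is a smooth modular form of weight $k$ for $\mathrm{SL}_2(\mathbb Z)$ with $\Delta_kM=g$, then $M$ does not have polynomial growth. 2. There is no $f\in V_{2-k}^1(0)$ with $\xi_{2-k}f=g$. -/

import Mathlib

open UpperHalfPlane
open scoped MatrixGroups ModularForm ContDiff

noncomputable section

namespace PolyMaass

/-- `f` is `C^∞` as a function of the two real variables `x, y`, where `z = x + iy`. -/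
def IsSmooth (f : ℍ → ℂ) : Prop :=
  ContDiffOn ℝ ∞ (f ∘ ofComplex) {z : ℂ | 0 < z.im}

/-- The partial derivative `∂f/∂x`. -/
def partialX (f : ℍ → ℂ) (z : ℍ) : ℂ :=
  fderiv ℝ (f ∘ ofComplex) (z : ℂ) 1

/-- The partial derivative `∂f/∂y`. -/
def partialY (f : ℍ → ℂ) (z : ℍ) : ℂ :=
  fderiv ℝ (f ∘ ofComplex) (z : ℂ) Complex.I

/-- The Wirtinger derivative `∂f/∂z̄ = (1/2) (∂f/∂x + i ∂f/∂y)`. -/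
def dbar (f : ℍ → ℂ) (z : ℍ) : ℂ :=
  (1 / 2 : ℂ) * (partialX f z + Complex.I * partialY f z)

/-- The operator `ξ_k f = 2 i y^k conj (∂f/∂z̄)`. -/
def xi (k : ℤ) (f : ℍ → ℂ) (z : ℍ) : ℂ :=
  2 * Complex.I * (z.im : ℂ) ^ k * (starRingEnd ℂ) (dbar f z)

/-- The weight `k` hyperbolic Laplacian
`Δ_k = y² (∂²/∂x² + ∂²/∂y²) - i k y (∂/∂x + i ∂/∂y)`. -/
def hypLaplacian (k : ℤ) (f : ℍ → ℂ) (z : ℍ) : ℂ :=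
  (z.im : ℂ) ^ 2 * (partialX (partialX f) z + partialY (partialY f) z)
    - Complex.I * (k : ℂ) * (z.im : ℂ) * (partialX f z + Complex.I * partialY f z)

/-- Smooth, not necessarily holomorphic, weight `k` modular forms for `SL(2, ℤ)`,
with no growth condition at the cusp. -/
structure IsSmoothModularForm (k : ℤ) (f : ℍ → ℂ) : Prop where
  smooth : IsSmooth f
  slash_eq : ∀ γ : SL(2, ℤ), f ∣[k] γ = f

/-- Moderate (polynomial) growth: for some real `α`, `f (x + iy) = O(y ^ α)` as `y → ∞`,
uniformly in `x`. -/
def HasModerateGrowth (f : ℍ → ℂ) : Prop :=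
  ∃ α : ℝ, f =O[atImInfty] fun z : ℍ => z.im ^ α

/-- The space `V_k^m(0)` of weight `k` polyharmonic Maass forms for `SL(2, ℤ)`, for integer `m`:
smooth modular forms of weight `k` and moderate growth with `(Δ_k)^m f = 0`. -/
def polyharmonicMaassForms (k : ℤ) (m : ℕ) : Set (ℍ → ℂ) :=
  {f | IsSmoothModularForm k f ∧ (hypLaplacian k)^[m] f = 0 ∧ HasModerateGrowth f}

end PolyMaass

end

namespace PolyMaass

open Complex MeasureTheory Set Filter Topology Asymptotics
open scoped Interval ComplexConjugate

/-! Both parts reduce to pairing `g` with a function F of weight 2 - k satisfying ∂F/∂z̄ = (i/2)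
conj(g) y^(k-2). For part 2 take F = f; for part 1 take F = ξ_k M, using the factorization Δ_k =
ξ_{2-k} ∘ ξ_k (`cauchyRiemann_xiAux`). The product h = F g has weight two and ∂h/∂z̄ = (i/2) |g|²
y^(k-2). Stokes' theorem on the standard fundamental domain cut off at height T identifies the mean
of h on the line y = T with the truncated Petersson norm of `g`. This is nonnegative and increasing
in T, so for T ≥ 3 the mean has real part at least some δ > 0 (`exists_re_integral_ge`,
`exists_re_integral_mul_ge`).

Moderate growth contradicts this because a cusp form decays exponentially. In part 2 the product f g
tends to zero at the cusp, so its means do too. In part 1 the growth condition controls M but not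
ξ_k M. The pairing is therefore averaged over a strip of height one and integrated by parts, so that
the derivative falls on conj(g) y^k (`exists_norm_integral_xiAux_mul_le`). This makes the average
smaller than δ. -/

/-! ### Stokes' theorem on a horizontal strip. -/

/-- The first order operator `∂/∂x + i ∂/∂y = 2 ∂/∂z̄` on functions of a complex variable. -/
noncomputable def cauchyRiemann (F : ℂ → ℂ) (z : ℂ) : ℂ :=
  fderiv ℝ F z 1 + Complex.I * fderiv ℝ F z Complex.I

lemma isOpen_im_pos : IsOpen {z : ℂ | 0 < z.im} := isOpen_lt continuous_const continuous_im

lemma contDiffAt_of_im_pos {n : WithTop ℕ∞} {F : ℂ → ℂ}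
    (hF : ContDiffOn ℝ n F {z : ℂ | 0 < z.im}) {z : ℂ} (hz : 0 < z.im) : ContDiffAt ℝ n F z :=
  hF.contDiffAt (isOpen_im_pos.mem_nhds hz)

lemma continuousOn_cauchyRiemann {F : ℂ → ℂ} (hF : ContDiffOn ℝ 1 F {z : ℂ | 0 < z.im}) :
    ContinuousOn (cauchyRiemann F) {z : ℂ | 0 < z.im} := by
  have h := hF.continuousOn_fderiv_of_isOpen isOpen_im_pos le_rfl
  exact (h.clm_apply continuousOn_const).add
    (continuousOn_const.mul (h.clm_apply continuousOn_const))

/-- Periodicity cancels the two vertical sides, so only the horizontal edges contribute. -/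
lemma integral_cauchyRiemann_strip {F : ℂ → ℂ} (hF : ContDiffOn ℝ 1 F {z : ℂ | 0 < z.im})
    (hper : ∀ z : ℂ, 0 < z.im → F (z + 1) = F z) {a b : ℝ} (ha : 0 < a) (hab : a ≤ b) :
    ∫ x in (-1 / 2 : ℝ)..(1 / 2), ∫ y in a..b, cauchyRiemann F (x + y * Complex.I) =
      Complex.I * ((∫ x in (-1 / 2 : ℝ)..(1 / 2), F (x + b * Complex.I)) -
        ∫ x in (-1 / 2 : ℝ)..(1 / 2), F (x + a * Complex.I)) := by
  have key : ∀ z, Complex.I • fderiv ℝ F z 1 - fderiv ℝ F z Complex.I = Complex.I * cauchyRiemann F z := by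
    intro z
    simp only [cauchyRiemann, smul_eq_mul]
    linear_combination -(fderiv ℝ F z Complex.I) * I_mul_I
  have hsub : [[(-1 / 2 : ℝ), 1 / 2]] ×ℂ [[a, b]] ⊆ {z : ℂ | 0 < z.im} := by
    intro z hz
    rw [mem_reProdIm, uIcc_of_le hab] at hz
    exact ha.trans_le hz.2.1
  have h := Complex.integral_boundary_rect_of_differentiableOn_real F
    (⟨-1 / 2, a⟩ : ℂ) (⟨1 / 2, b⟩ : ℂ)
    ((hF.differentiableOn one_ne_zero).mono hsub) (by
      simp only [key]
      refine ContinuousOn.integrableOn_compact (isCompact_uIcc.reProdIm isCompact_uIcc) ?_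
      exact continuousOn_const.mul ((continuousOn_cauchyRiemann hF).mono hsub))
  simp only [key] at h
  have hside : ∫ y in a..b, F (((1 / 2 : ℝ) : ℂ) + y * Complex.I) =
      ∫ y in a..b, F (((-1 / 2 : ℝ) : ℂ) + y * Complex.I) := by
    refine intervalIntegral.integral_congr fun y hy ↦ ?_
    rw [uIcc_of_le hab] at hy
    have := hper (((-1 / 2 : ℝ) : ℂ) + y * Complex.I) (by simpa using ha.trans_le hy.1)
    rw [← this]
    congr 1
    push_cast
    ring
  rw [hside] at h
  simp only [intervalIntegral.integral_const_mul] at h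
  linear_combination Complex.I * h + (∫ x in (-1 / 2 : ℝ)..(1 / 2), ∫ y in a..b,
    cauchyRiemann F (x + y * Complex.I)) * I_mul_I

/-! ### Stokes' theorem on the truncated fundamental domain. -/

/-- A parametrization by the unit square `[-1/2, 1/2] × [0, 1]` of the part of the standard
fundamental domain below height `2`. -/
noncomputable def domainParam (p : ℝ × ℝ) : ℂ :=
  p.1 + ((1 - p.2) * √(1 - p.1 ^ 2) + p.2 * 2 : ℝ) * Complex.I

lemma domainParam_im (p : ℝ × ℝ) :
    (domainParam p).im = (1 - p.2) * √(1 - p.1 ^ 2) + p.2 * 2 := by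
  simp [domainParam]

lemma sq_lt_one_of_mem_uIcc {x : ℝ} (hx : x ∈ [[(-1 / 2 : ℝ), 1 / 2]]) : 0 < 1 - x ^ 2 := by
  rw [uIcc_of_le (by norm_num)] at hx
  nlinarith [hx.1, hx.2]

lemma domainParam_im_pos {p : ℝ × ℝ} (h1 : p.1 ∈ [[(-1 / 2 : ℝ), 1 / 2]])
    (h2 : p.2 ∈ [[(0 : ℝ), 1]]) : 0 < (domainParam p).im := by
  have hs := Real.sqrt_pos.2 (sq_lt_one_of_mem_uIcc h1)
  rw [uIcc_of_le zero_le_one] at h2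
  rw [domainParam_im]
  rcases h2.1.eq_or_lt with h | h
  · rw [← h]; linarith
  · have := mul_nonneg (sub_nonneg.2 h2.2) hs.le
    linarith

lemma hasDerivAt_sqrt_one_sub_sq {x : ℝ} (hx : 0 < 1 - x ^ 2) :
    HasDerivAt (fun x : ℝ ↦ √(1 - x ^ 2)) (-x / √(1 - x ^ 2)) x := by
  have h : HasDerivAt (fun x : ℝ ↦ 1 - x ^ 2) (-(2 * x)) x := by
    simpa using (hasDerivAt_pow 2 x).const_sub 1
  convert h.sqrt hx.ne' using 1
  field_simp

lemma differentiableAt_sqrt_fst {p : ℝ × ℝ} (hp : 0 < 1 - p.1 ^ 2) :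
    DifferentiableAt ℝ (fun p : ℝ × ℝ ↦ √(1 - p.1 ^ 2)) p :=
  (by fun_prop : DifferentiableAt ℝ (fun p : ℝ × ℝ ↦ 1 - p.1 ^ 2) p).sqrt hp.ne'

lemma differentiableAt_ofReal_comp {E : Type*} [NormedAddCommGroup E] [NormedSpace ℝ E]
    {u : E → ℝ} {p : E} (hu : DifferentiableAt ℝ u p) :
    DifferentiableAt ℝ (fun p ↦ (u p : ℂ)) p :=
  ofRealCLM.differentiableAt.comp p hu

lemma differentiableAt_domainParam {p : ℝ × ℝ} (hp : 0 < 1 - p.1 ^ 2) :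
    DifferentiableAt ℝ domainParam p := by
  have hs := differentiableAt_sqrt_fst hp
  refine (differentiableAt_ofReal_comp differentiableAt_fst).add
    ((differentiableAt_ofReal_comp (?_ : DifferentiableAt ℝ
      (fun p : ℝ × ℝ ↦ (1 - p.2) * √(1 - p.1 ^ 2) + p.2 * 2) p)).mul_const Complex.I)
  fun_prop

lemma continuous_domainParam : Continuous domainParam := by
  unfold domainParam
  fun_prop

lemma fderiv_apply_add_mul_I (F : ℂ → ℂ) (z : ℂ) (a b : ℝ) :
    fderiv ℝ F z (a + b * Complex.I) = a * fderiv ℝ F z 1 + b * fderiv ℝ F z Complex.I := by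
  have : (a + b * Complex.I : ℂ) = a • (1 : ℂ) + b • Complex.I := by simp
  rw [this, map_add, map_smul, map_smul]
  simp

/-- The function `(y_top - y_bottom) h` on the unit square. -/
noncomputable def fluxX (h : ℂ → ℂ) (p : ℝ × ℝ) : ℂ :=
  ((2 - √(1 - p.1 ^ 2) : ℝ) : ℂ) * h (domainParam p)

/-- The vertical component of the vector field whose divergence is the pull-back of
`cauchyRiemann h`. -/
noncomputable def fluxY (h : ℂ → ℂ) (p : ℝ × ℝ) : ℂ :=
  (Complex.I + (((1 - p.2) * (p.1 / √(1 - p.1 ^ 2)) : ℝ) : ℂ)) * h (domainParam p)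

lemma differentiableAt_fluxX {h : ℂ → ℂ} {p : ℝ × ℝ} (hp : 0 < 1 - p.1 ^ 2)
    (hh : DifferentiableAt ℝ h (domainParam p)) : DifferentiableAt ℝ (fluxX h) p := by
  have hs := differentiableAt_sqrt_fst hp
  exact (differentiableAt_ofReal_comp (hs.const_sub 2)).mul
    (hh.comp p (differentiableAt_domainParam hp))

lemma differentiableAt_fluxY {h : ℂ → ℂ} {p : ℝ × ℝ} (hp : 0 < 1 - p.1 ^ 2)
    (hh : DifferentiableAt ℝ h (domainParam p)) : DifferentiableAt ℝ (fluxY h) p := by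
  have hs := differentiableAt_sqrt_fst hp
  have h0 := (Real.sqrt_pos.2 hp).ne'
  refine ((differentiableAt_ofReal_comp (?_ : DifferentiableAt ℝ
    (fun p : ℝ × ℝ ↦ (1 - p.2) * (p.1 / √(1 - p.1 ^ 2))) p)).const_add Complex.I).mul
    (hh.comp p (differentiableAt_domainParam hp))
  exact (differentiableAt_snd.const_sub 1).mul (by fun_prop (disch := assumption))

/-- `fluxX` and `fluxY` are the pull-back of the vector field (h, i h), whose divergence is
`cauchyRiemann h`. The factor 2 - √(1 - x²) is the Jacobian of `domainParam`. Pulling back turns the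
curved domain into a rectangle. -/
lemma divergence_flux {h : ℂ → ℂ} {p : ℝ × ℝ} (hp : 0 < 1 - p.1 ^ 2)
    (hh : DifferentiableAt ℝ h (domainParam p)) :
    fderiv ℝ (fluxX h) p (1, 0) + fderiv ℝ (fluxY h) p (0, 1) =
      ((2 - √(1 - p.1 ^ 2) : ℝ) : ℂ) * cauchyRiemann h (domainParam p) := by
  obtain ⟨x, t⟩ := p
  simp only at hp
  have hs := hasDerivAt_sqrt_one_sub_sq hp
  have hX : HasDerivAt (fun x : ℝ ↦ domainParam (x, t))
      ((1 : ℝ) + ((1 - t) * (-x / √(1 - x ^ 2)) : ℝ) * Complex.I) x := by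
    exact (hasDerivAt_id x).ofReal_comp.add
      (((hs.const_mul (1 - t)).add_const (t * 2)).ofReal_comp.mul_const Complex.I)
  have hT : HasDerivAt (fun t : ℝ ↦ domainParam (x, t))
      ((0 : ℝ) + (-1 * √(1 - x ^ 2) + 1 * 2 : ℝ) * Complex.I) t := by
    exact (hasDerivAt_const t x).ofReal_comp.add
      (((((hasDerivAt_id t).const_sub 1).mul_const (√(1 - x ^ 2))).add
        ((hasDerivAt_id t).mul_const 2)).ofReal_comp.mul_const Complex.I)
  have hhX := hh.hasFDerivAt.comp_hasDerivAt x hX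
  have hhT := hh.hasFDerivAt.comp_hasDerivAt t hT
  have e1 : HasDerivAt (fun x : ℝ ↦ (x, t)) ((1 : ℝ), (0 : ℝ)) x :=
    (hasDerivAt_id x).prodMk (hasDerivAt_const x t)
  have e2 : HasDerivAt (fun t : ℝ ↦ (x, t)) ((0 : ℝ), (1 : ℝ)) t :=
    (hasDerivAt_const t x).prodMk (hasDerivAt_id t)
  have d1 := (differentiableAt_fluxX hp hh).hasFDerivAt.comp_hasDerivAt x e1
  have d2 := (differentiableAt_fluxY hp hh).hasFDerivAt.comp_hasDerivAt t e2
  have d1' := (hs.const_sub 2).ofReal_comp.mul hhX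
  have d2' := ((((hasDerivAt_id t).const_sub 1).mul_const
    (x / √(1 - x ^ 2))).ofReal_comp.const_add Complex.I).mul hhT
  rw [d1.unique d1', d2.unique d2', fderiv_apply_add_mul_I, fderiv_apply_add_mul_I]
  simp only [cauchyRiemann, Function.comp, id]
  push_cast
  ring

/-- Translation by 1 cancels the vertical sides and z ↦ -1/z folds the unit arc onto itself, so only
the edge at height 2 survives. -/
lemma integral_cauchyRiemann_domain {h : ℂ → ℂ} (hh : ContDiffOn ℝ 1 h {z : ℂ | 0 < z.im})
    (hper : ∀ z : ℂ, 0 < z.im → h (z + 1) = h z)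
    (hS : ∀ z : ℂ, 0 < z.im → h (-1 / z) = z ^ 2 * h z) :
    ∫ x in (-1 / 2 : ℝ)..(1 / 2), ∫ t in (0 : ℝ)..1,
      ((2 - √(1 - x ^ 2) : ℝ) : ℂ) * cauchyRiemann h (domainParam (x, t)) =
      Complex.I * ∫ x in (-1 / 2 : ℝ)..(1 / 2), h (x + (2 : ℝ) * Complex.I) := by
  have hdiff : ∀ p ∈ [[(-1 / 2 : ℝ), 1 / 2]] ×ˢ [[(0 : ℝ), 1]],
      0 < 1 - p.1 ^ 2 ∧ DifferentiableAt ℝ h (domainParam p) := fun p hp ↦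
    ⟨sq_lt_one_of_mem_uIcc hp.1, (contDiffAt_of_im_pos hh
      (domainParam_im_pos hp.1 hp.2)).differentiableAt one_ne_zero⟩
  have hsub : Ioo (min (-1 / 2 : ℝ) (1 / 2)) (max (-1 / 2) (1 / 2)) ×ˢ
      Ioo (min (0 : ℝ) 1) (max 0 1) ⊆ [[(-1 / 2 : ℝ), 1 / 2]] ×ˢ [[(0 : ℝ), 1]] :=
    Set.prod_mono Ioo_subset_Icc_self Ioo_subset_Icc_self
  have hmaps : MapsTo domainParam ([[(-1 / 2 : ℝ), 1 / 2]] ×ˢ [[(0 : ℝ), 1]])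
      {z : ℂ | 0 < z.im} := fun p hp ↦ domainParam_im_pos hp.1 hp.2
  have H := integral2_divergence_prod_of_hasFDerivAt (fluxX h) (fluxY h)
    (fderiv ℝ (fluxX h)) (fderiv ℝ (fluxY h)) (-1 / 2) 0 (1 / 2) 1
    (fun p hp ↦ (differentiableAt_fluxX (hdiff p hp).1
      (hdiff p hp).2).continuousAt.continuousWithinAt)
    (fun p hp ↦ (differentiableAt_fluxY (hdiff p hp).1
      (hdiff p hp).2).continuousAt.continuousWithinAt)
    (fun p hp ↦ (differentiableAt_fluxX (hdiff p (hsub hp)).1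
      (hdiff p (hsub hp)).2).hasFDerivAt)
    (fun p hp ↦ (differentiableAt_fluxY (hdiff p (hsub hp)).1
      (hdiff p (hsub hp)).2).hasFDerivAt) (by
      refine IntegrableOn.congr_fun (f := fun p ↦
        ((2 - √(1 - p.1 ^ 2) : ℝ) : ℂ) * cauchyRiemann h (domainParam p)) ?_
        (fun p hp ↦ (divergence_flux (hdiff p hp).1 (hdiff p hp).2).symm)
        (measurableSet_uIcc.prod measurableSet_uIcc)
      refine ContinuousOn.integrableOn_compact (isCompact_uIcc.prod isCompact_uIcc) ?_
      refine ContinuousOn.mul (by fun_prop) ?_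
      exact (continuousOn_cauchyRiemann hh).comp continuous_domainParam.continuousOn hmaps)
  have hL : ∫ x in (-1 / 2 : ℝ)..(1 / 2), ∫ t in (0 : ℝ)..1,
      fderiv ℝ (fluxX h) (x, t) (1, 0) + fderiv ℝ (fluxY h) (x, t) (0, 1) =
      ∫ x in (-1 / 2 : ℝ)..(1 / 2), ∫ t in (0 : ℝ)..1,
      ((2 - √(1 - x ^ 2) : ℝ) : ℂ) * cauchyRiemann h (domainParam (x, t)) := by
    refine intervalIntegral.integral_congr fun x hx ↦ ?_
    refine intervalIntegral.integral_congr fun t ht ↦ ?_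
    exact divergence_flux (hdiff (x, t) ⟨hx, ht⟩).1 (hdiff (x, t) ⟨hx, ht⟩).2
  have hside : ∫ t in (0 : ℝ)..1, fluxX h (1 / 2, t) = ∫ t in (0 : ℝ)..1, fluxX h (-1 / 2, t) := by
    refine intervalIntegral.integral_congr fun t ht ↦ ?_
    have := hper (domainParam (-1 / 2, t)) (domainParam_im_pos left_mem_uIcc ht)
    simp only [fluxX]
    have e : domainParam (1 / 2, t) = domainParam (-1 / 2, t) + 1 := by
      simp only [domainParam]
      norm_num
      ring
    rw [e, this]
    norm_num
  have htop : ∀ x : ℝ, fluxY h (x, 1) = Complex.I * h (x + (2 : ℝ) * Complex.I) := by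
    intro x
    simp [fluxY, domainParam]
  -- On the arc `fluxY h (x, 0)` dx is i h dz. The form h dz is invariant under z ↦ -1/z, which acts
  -- on the unit circle as x ↦ -x, so the integrand is odd.
  have hbot : ∫ x in (-1 / 2 : ℝ)..(1 / 2), fluxY h (x, 0) = 0 := by
    have hodd : ∀ x ∈ [[(-1 / 2 : ℝ), 1 / 2]], fluxY h (-x, 0) = -fluxY h (x, 0) := by
      intro x hx
      have hpos := sq_lt_one_of_mem_uIcc hx
      have him := domainParam_im_pos (p := (x, 0)) hx left_mem_uIcc
      have hz := hS _ him
      have hsq : (√(1 - x ^ 2) : ℂ) ^ 2 = 1 - x ^ 2 := by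
        exact_mod_cast congrArg (fun r : ℝ ↦ (r : ℂ)) (Real.sq_sqrt hpos.le)
      have hs0 : (√(1 - x ^ 2) : ℂ) ≠ 0 := by
        exact_mod_cast (Real.sqrt_pos.2 hpos).ne'
      have hzv : domainParam (x, 0) = x + √(1 - x ^ 2) * Complex.I := by simp [domainParam]
      have hz0 : domainParam (x, 0) ≠ 0 := by
        intro h0
        rw [h0] at him
        simp at him
      have e : domainParam (-x, 0) = -1 / domainParam (x, 0) := by
        rw [eq_div_iff hz0, hzv]
        simp only [domainParam]
        simp only [sub_zero, one_mul, zero_mul, add_zero, even_two, Even.neg_pow]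
        push_cast
        linear_combination (√(1 - x ^ 2) : ℂ) ^ 2 * I_sq - hsq
      simp only [fluxY, e, hz]
      rw [hzv]
      simp only [sub_zero, one_mul, even_two, Even.neg_pow]
      push_cast
      generalize h (x + √(1 - x ^ 2) * Complex.I) = w
      field_simp
      linear_combination (x + √(1 - x ^ 2) * Complex.I) * w * (√(1 - x ^ 2) ^ 2 * I_sq - hsq)
    have h1 : ∫ x in (-1 / 2 : ℝ)..(1 / 2), fluxY h (-x, 0) =
        ∫ x in (-1 / 2 : ℝ)..(1 / 2), fluxY h (x, 0) := by
      rw [intervalIntegral.integral_comp_neg (fun x ↦ fluxY h (x, 0))]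
      norm_num
    rw [intervalIntegral.integral_congr hodd, intervalIntegral.integral_neg] at h1
    exact self_eq_neg.1 h1.symm
  rw [hL, hside, hbot] at H
  simp only [htop] at H
  rw [H, intervalIntegral.integral_const_mul]
  ring

/-! ### Calculus of ∂/∂z̄ and iterated integrals over rectangles. -/

lemma cauchyRiemann_mul {u v : ℂ → ℂ} {z : ℂ} (hu : DifferentiableAt ℝ u z)
    (hv : DifferentiableAt ℝ v z) : cauchyRiemann (fun w ↦ u w * v w) z =
      cauchyRiemann u z * v z + u z * cauchyRiemann v z := by
  simp only [cauchyRiemann, fderiv_fun_mul hu hv, add_apply,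
    smul_apply, smul_eq_mul]
  ring

lemma fderiv_real_apply {G : ℂ → ℂ} {z : ℂ} (hG : DifferentiableAt ℂ G z) (v : ℂ) :
    fderiv ℝ G z v = v * deriv G z := by
  rw [hG.fderiv_restrictScalars ℝ]
  simp

lemma cauchyRiemann_of_differentiableAt {G : ℂ → ℂ} {z : ℂ} (hG : DifferentiableAt ℂ G z) :
    cauchyRiemann G z = 0 := by
  simp only [cauchyRiemann, fderiv_real_apply hG]
  linear_combination deriv G z * I_sq

lemma cauchyRiemann_congr {u v : ℂ → ℂ} {z : ℂ} (h : u =ᶠ[𝓝 z] v) :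
    cauchyRiemann u z = cauchyRiemann v z := by
  simp only [cauchyRiemann, h.fderiv_eq]

lemma contDiffOn_real_of_differentiableOn {G : ℂ → ℂ}
    (hG : DifferentiableOn ℂ G {z : ℂ | 0 < z.im}) {n : WithTop ℕ∞} :
    ContDiffOn ℝ n G {z : ℂ | 0 < z.im} :=
  (hG.contDiffOn isOpen_im_pos).restrict_scalars ℝ

/-- Replacing y by max y 1 gives a function continuous on the whole plane that is unchanged for y ≥
1. Results on parametric integrals that ask for global continuity then apply. -/
lemma continuous_clamped {E : Type*} [TopologicalSpace E] {φ : ℂ → E}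
    (hφ : ContinuousOn φ {z : ℂ | 0 < z.im}) :
    Continuous fun p : ℝ × ℝ ↦ φ (p.1 + (max p.2 1 : ℝ) * Complex.I) := by
  refine hφ.comp_continuous (by fun_prop) fun p ↦ ?_
  simp

lemma integral_rect_eq_clamped {E : Type*} [NormedAddCommGroup E] [NormedSpace ℝ E] (φ : ℂ → E)
    {a b c d : ℝ} (hc : 1 ≤ c) (hd : 1 ≤ d) :
    ∫ x in a..b, ∫ y in c..d, φ (x + y * Complex.I) =
      ∫ x in a..b, ∫ y in c..d, φ (x + (max y 1 : ℝ) * Complex.I) := by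
  refine intervalIntegral.integral_congr fun x _ ↦ intervalIntegral.integral_congr fun y hy ↦ ?_
  have : 1 ≤ y := (le_min hc hd).trans hy.1
  simp only [max_eq_left this]

lemma integral_rect_pos {φ : ℂ → ℝ} (hφ : ContinuousOn φ {z : ℂ | 0 < z.im})
    (hφ0 : ∀ z : ℂ, 0 < z.im → 0 ≤ φ z) {a b c d x₀ y₀ : ℝ} (hc : 1 ≤ c)
    (hx₀ : x₀ ∈ Ioo a b) (hy₀ : y₀ ∈ Ioo c d) (h0 : φ (x₀ + y₀ * Complex.I) ≠ 0) :
    0 < ∫ x in a..b, ∫ y in c..d, φ (x + y * Complex.I) := by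
  have hcd := hy₀.1.trans hy₀.2
  rw [integral_rect_eq_clamped φ hc (hc.trans hcd.le)]
  have hcont := continuous_clamped hφ
  have hnn : ∀ x y : ℝ, 0 ≤ φ (x + (max y 1 : ℝ) * Complex.I) := fun x y ↦
    hφ0 _ (by simp)
  refine intervalIntegral.integral_pos (hx₀.1.trans hx₀.2)
    (intervalIntegral.continuous_parametric_intervalIntegral_of_continuous' hcont c d).continuousOn
    (fun x _ ↦ intervalIntegral.integral_nonneg hcd.le fun y _ ↦ hnn x y)
    ⟨x₀, Ioo_subset_Icc_self hx₀, ?_⟩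
  refine intervalIntegral.integral_pos hcd
    (hcont.comp (by fun_prop : Continuous fun y : ℝ ↦ (x₀, y))).continuousOn
    (fun y _ ↦ hnn x₀ y) ⟨y₀, Ioo_subset_Icc_self hy₀, (hnn x₀ y₀).lt_of_ne ?_⟩
  rw [max_eq_left (hc.trans hy₀.1.le)]
  exact h0.symm

lemma integral_rect_swap {φ : ℂ → ℂ} (hφ : ContinuousOn φ {z : ℂ | 0 < z.im})
    {a b c d : ℝ} (hab : a ≤ b) (hc : 1 ≤ c) (hcd : c ≤ d) :
    ∫ x in a..b, ∫ y in c..d, φ (x + y * Complex.I) =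
      ∫ y in c..d, ∫ x in a..b, φ (x + y * Complex.I) := by
  refine intervalIntegral_intervalIntegral_swap ?_
  rw [uIoc_of_le hab, uIoc_of_le hcd]
  refine IntegrableOn.mono_set (t := Icc a b ×ˢ Icc c d) ?_
    (Set.prod_mono Ioc_subset_Icc_self Ioc_subset_Icc_self)
  refine ContinuousOn.integrableOn_compact (isCompact_Icc.prod isCompact_Icc) ?_
  refine hφ.comp (by fun_prop) fun p hp ↦ ?_
  have : c ≤ p.2 := hp.2.1
  simp only [mem_ofPred_eq, add_im, ofReal_im, mul_im, ofReal_re, Complex.I_im, Complex.I_re]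
  linarith

/-! ### The lower bound for the pairing. -/

/-- If `∂h/∂z̄` is `i/2` times a nonnegative function, for `h` with the transformation behaviour of a
weight two form, then Stokes' theorem bounds the mean values of `h` on horizontal lines. -/
lemma exists_re_integral_ge {h : ℂ → ℂ} {φ : ℂ → ℝ} (hh : ContDiffOn ℝ 1 h {z : ℂ | 0 < z.im})
    (hper : ∀ z : ℂ, 0 < z.im → h (z + 1) = h z)
    (hS : ∀ z : ℂ, 0 < z.im → h (-1 / z) = z ^ 2 * h z)
    (hφ : ContinuousOn φ {z : ℂ | 0 < z.im}) (hφ0 : ∀ z : ℂ, 0 < z.im → 0 ≤ φ z)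
    (hcr : ∀ z : ℂ, 0 < z.im → cauchyRiemann h z = Complex.I * φ z)
    (hne : ∃ x₀ ∈ Ioo (-1 / 2 : ℝ) (1 / 2), ∃ y₀ ∈ Ioo (2 : ℝ) 3, φ (x₀ + y₀ * Complex.I) ≠ 0) :
    ∃ δ > 0, ∀ T : ℝ, 3 ≤ T →
      δ ≤ (∫ x in (-1 / 2 : ℝ)..(1 / 2), h (x + T * Complex.I)).re := by
  obtain ⟨x₀, hx₀, y₀, hy₀, h0⟩ := hne
  have hstrip : ∀ a b : ℝ, 0 < a → a ≤ b →
      (∫ x in (-1 / 2 : ℝ)..(1 / 2), h (x + b * Complex.I)).re =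
      (∫ x in (-1 / 2 : ℝ)..(1 / 2), h (x + a * Complex.I)).re +
      ∫ x in (-1 / 2 : ℝ)..(1 / 2), ∫ y in a..b, φ (x + y * Complex.I) := by
    intro a b ha hab
    have H := integral_cauchyRiemann_strip hh hper ha hab
    have e : ∫ x in (-1 / 2 : ℝ)..(1 / 2), ∫ y in a..b, cauchyRiemann h (x + y * Complex.I) =
        Complex.I * (∫ x in (-1 / 2 : ℝ)..(1 / 2), ∫ y in a..b, φ (x + y * Complex.I) : ℝ) := by
      rw [← intervalIntegral.integral_ofReal, ← intervalIntegral.integral_const_mul]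
      refine intervalIntegral.integral_congr fun x _ ↦ ?_
      rw [← intervalIntegral.integral_ofReal, ← intervalIntegral.integral_const_mul]
      refine intervalIntegral.integral_congr fun y hy ↦ ?_
      rw [uIcc_of_le hab] at hy
      exact hcr _ (by simpa using ha.trans_le hy.1)
    rw [e] at H
    have H' := mul_left_cancel₀ Complex.I_ne_zero H
    have := congrArg Complex.re H'
    rw [ofReal_re, sub_re] at this
    linarith
  have hbase : 0 ≤ (∫ x in (-1 / 2 : ℝ)..(1 / 2), h (x + (2 : ℝ) * Complex.I)).re := by
    have H := integral_cauchyRiemann_domain hh hper hS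
    have e : ∫ x in (-1 / 2 : ℝ)..(1 / 2), ∫ t in (0 : ℝ)..1,
        ((2 - √(1 - x ^ 2) : ℝ) : ℂ) * cauchyRiemann h (domainParam (x, t)) =
        Complex.I * (∫ x in (-1 / 2 : ℝ)..(1 / 2), ∫ t in (0 : ℝ)..1,
          (2 - √(1 - x ^ 2)) * φ (domainParam (x, t)) : ℝ) := by
      rw [← intervalIntegral.integral_ofReal, ← intervalIntegral.integral_const_mul]
      refine intervalIntegral.integral_congr fun x hx ↦ ?_
      rw [← intervalIntegral.integral_ofReal, ← intervalIntegral.integral_const_mul]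
      refine intervalIntegral.integral_congr fun t ht ↦ ?_
      rw [hcr _ (domainParam_im_pos hx ht)]
      push_cast
      ring
    rw [e] at H
    rw [← mul_left_cancel₀ Complex.I_ne_zero H, ofReal_re]
    refine intervalIntegral.integral_nonneg (by norm_num) fun x hx ↦ ?_
    refine intervalIntegral.integral_nonneg zero_le_one fun t ht ↦ ?_
    have hx' : x ∈ [[(-1 / 2 : ℝ), 1 / 2]] := by rwa [uIcc_of_le (by norm_num)]
    have ht' : t ∈ [[(0 : ℝ), 1]] := by rwa [uIcc_of_le zero_le_one]
    refine mul_nonneg ?_ (hφ0 _ (domainParam_im_pos hx' ht'))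
    have : √(1 - x ^ 2) ≤ 1 := Real.sqrt_le_one.2 (by nlinarith [sq_nonneg x])
    linarith
  -- δ is the integral of φ over the rectangle between heights 2 and 3. The regions below 2 and
  -- above 3 contribute nonnegatively.
  refine ⟨_, integral_rect_pos hφ hφ0 (by norm_num) hx₀ hy₀ h0, fun T hT ↦ ?_⟩
  rw [hstrip 3 T (by norm_num) hT, hstrip 2 3 (by norm_num) (by norm_num)]
  have : 0 ≤ ∫ x in (-1 / 2 : ℝ)..(1 / 2), ∫ y in (3 : ℝ)..T, φ (x + y * Complex.I) := by
    refine intervalIntegral.integral_nonneg (by norm_num) fun x _ ↦ ?_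
    refine intervalIntegral.integral_nonneg hT fun y hy ↦ ?_
    exact hφ0 _ (by simpa using (by norm_num : (0 : ℝ) < 3).trans_le hy.1)
  linarith

/-- Pairing a holomorphic function `G` of weight `k` with a solution `F` of
`∂F/∂z̄ = (i/2) conj G y^(k-2)` of weight `2 - k`. -/
lemma exists_re_integral_mul_ge {k : ℤ} {F G : ℂ → ℂ} (hF : ContDiffOn ℝ 1 F {z : ℂ | 0 < z.im})
    (hFper : ∀ z : ℂ, 0 < z.im → F (z + 1) = F z)
    (hFS : ∀ z : ℂ, 0 < z.im → F (-1 / z) = z ^ (2 - k) * F z)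
    (hG : DifferentiableOn ℂ G {z : ℂ | 0 < z.im})
    (hGper : ∀ z : ℂ, 0 < z.im → G (z + 1) = G z)
    (hGS : ∀ z : ℂ, 0 < z.im → G (-1 / z) = z ^ k * G z)
    (hcr : ∀ z : ℂ, 0 < z.im →
      cauchyRiemann F z = Complex.I * (starRingEnd ℂ (G z) * (z.im : ℂ) ^ (k - 2)))
    (hG0 : ∃ z : ℂ, 0 < z.im ∧ G z ≠ 0) :
    ∃ δ > 0, ∀ T : ℝ, 3 ≤ T → δ ≤
      (∫ x in (-1 / 2 : ℝ)..(1 / 2), F (x + T * Complex.I) * G (x + T * Complex.I)).re := by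
  refine exists_re_integral_ge (h := fun z ↦ F z * G z)
    (φ := fun z ↦ normSq (G z) * z.im ^ (k - 2))
    (hF.mul (contDiffOn_real_of_differentiableOn hG)) (fun z hz ↦ ?_) (fun z hz ↦ ?_) ?_
    (fun z hz ↦ ?_) (fun z hz ↦ ?_) ?_
  · simp only [hFper z hz, hGper z hz]
  · have hz0 : z ≠ 0 := by
      rintro rfl
      simp at hz
    simp only [hFS z hz, hGS z hz]
    rw [mul_mul_mul_comm, ← zpow_add₀ hz0, sub_add_cancel]
    norm_cast
  · exact (continuous_normSq.comp_continuousOn hG.continuousOn).mul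
      (continuous_im.continuousOn.zpow₀ _ fun z hz ↦ Or.inl (ne_of_gt hz))
  · exact mul_nonneg (normSq_nonneg _) (zpow_nonneg hz.le _)
  · have hGz : DifferentiableAt ℂ G z := hG.differentiableAt (isOpen_im_pos.mem_nhds hz)
    have hFz := (contDiffAt_of_im_pos hF hz).differentiableAt one_ne_zero
    rw [cauchyRiemann_mul hFz (hGz.restrictScalars ℝ), cauchyRiemann_of_differentiableAt hGz,
      hcr z hz]
    push_cast
    rw [normSq_eq_conj_mul_self]
    ring
  -- If G vanished on the whole open box, the identity theorem would make it zero on the upper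
  -- half-plane. The point 5i/2 is the centre of the box.
  · by_contra! hcon
    obtain ⟨w, hw, hGw⟩ := hG0
    refine hGw ?_
    have han : AnalyticOnNhd ℂ G {z : ℂ | 0 < z.im} := hG.analyticOnNhd isOpen_im_pos
    have hconn : IsPreconnected {z : ℂ | 0 < z.im} := (convex_halfSpace_im_gt 0).isPreconnected
    have hz₀ : (0 : ℝ) < ((⟨0, 5 / 2⟩ : ℂ)).im := by norm_num
    refine han.eqOn_zero_of_preconnected_of_eventuallyEq_zero hconn hz₀ ?_ hw
    have hopen : IsOpen (Ioo (-1 / 2 : ℝ) (1 / 2) ×ℂ Ioo (2 : ℝ) 3) :=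
      isOpen_Ioo.reProdIm isOpen_Ioo
    filter_upwards [hopen.mem_nhds (x := (⟨0, 5 / 2⟩ : ℂ)) (by
      rw [mem_reProdIm]; constructor <;> constructor <;> norm_num)] with z hz
    rw [mem_reProdIm] at hz
    have := hcon z.re hz.1 z.im hz.2
    simp only [Complex.re_add_im] at this
    have hpos : 0 < z.im := by linarith [hz.2.1]
    simpa [(zpow_pos hpos (k - 2)).ne'] using this

/-! ### The operator ξ_k: modularity and the factorization of the Laplacian. -/

lemma cauchyRiemann_comp {M σ : ℂ → ℂ} {z : ℂ} (hM : DifferentiableAt ℝ M (σ z))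
    (hσ : DifferentiableAt ℂ σ z) :
    cauchyRiemann (fun w ↦ M (σ w)) z = conj (deriv σ z) * cauchyRiemann M (σ z) := by
  have hchain : ∀ v, fderiv ℝ (fun w ↦ M (σ w)) z v = fderiv ℝ M (σ z) (v * deriv σ z) := by
    intro v
    have := fderiv_comp z hM (hσ.restrictScalars ℝ)
    rw [show (fun w ↦ M (σ w)) = M ∘ σ from rfl, this, ContinuousLinearMap.comp_apply,
      fderiv_real_apply hσ]
  have e1 : 1 * deriv σ z = (deriv σ z).re + (deriv σ z).im * Complex.I := by
    rw [one_mul, Complex.re_add_im]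
  have e2 : Complex.I * deriv σ z =
      ((-(deriv σ z).im : ℝ) : ℂ) + (deriv σ z).re * Complex.I := by
    apply Complex.ext <;> simp
  have e3 : conj (deriv σ z) = (deriv σ z).re - (deriv σ z).im * Complex.I := by
    apply Complex.ext <;> simp
  simp only [cauchyRiemann, hchain]
  rw [e1, e2, e3, fderiv_apply_add_mul_I, fderiv_apply_add_mul_I]
  push_cast
  linear_combination (deriv σ z).im * fderiv ℝ M (σ z) Complex.I * I_sq

lemma fderiv_conj {W : ℂ → ℂ} {z : ℂ} (hW : DifferentiableAt ℝ W z) (v : ℂ) :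
    fderiv ℝ (fun w ↦ conj (W w)) z v = conj (fderiv ℝ W z v) := by
  have := (conjCLE.toContinuousLinearMap.hasFDerivAt.comp z hW.hasFDerivAt).fderiv
  have h2 : fderiv ℝ (fun w ↦ conj (W w)) z =
      conjCLE.toContinuousLinearMap.comp (fderiv ℝ W z) := this
  rw [h2]
  rfl

lemma cauchyRiemann_conj {W : ℂ → ℂ} {z : ℂ} (hW : DifferentiableAt ℝ W z) :
    cauchyRiemann (fun w ↦ conj (W w)) z =
      conj (fderiv ℝ W z 1 - Complex.I * fderiv ℝ W z Complex.I) := by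
  simp only [cauchyRiemann, fderiv_conj hW, map_sub, map_mul, conj_I]
  ring

lemma hasFDerivAt_im_zpow (k : ℤ) {z : ℂ} (hz : 0 < z.im) :
    HasFDerivAt (fun w : ℂ ↦ ((w.im ^ k : ℝ) : ℂ))
      (ofRealCLM.comp (((k : ℝ) * z.im ^ (k - 1)) • imCLM)) z :=
  ofRealCLM.hasFDerivAt.comp z
    ((hasDerivAt_zpow k z.im (Or.inl hz.ne')).comp_hasFDerivAt z imCLM.hasFDerivAt)

lemma cauchyRiemann_im_zpow (k : ℤ) {z : ℂ} (hz : 0 < z.im) :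
    cauchyRiemann (fun w : ℂ ↦ ((w.im ^ k : ℝ) : ℂ)) z =
      Complex.I * ((k * z.im ^ (k - 1) : ℝ) : ℂ) := by
  simp only [cauchyRiemann, (hasFDerivAt_im_zpow k hz).fderiv]
  simp

lemma contDiffOn_im_zpow (k : ℤ) {n : WithTop ℕ∞} :
    ContDiffOn ℝ n (fun w : ℂ ↦ ((w.im ^ k : ℝ) : ℂ)) {z : ℂ | 0 < z.im} := by
  intro z hz
  refine ContDiffAt.contDiffWithinAt ?_
  have hz' : z.im ≠ 0 := ne_of_gt hz
  have hpow : ContDiffAt ℝ n (fun y : ℝ ↦ y ^ k) z.im := by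
    cases k with
    | ofNat m => simpa using contDiffAt_id.pow m
    | negSucc m =>
      simp only [zpow_negSucc]
      exact (contDiffAt_id.pow (m + 1)).inv (pow_ne_zero _ hz')
  exact ofRealCLM.contDiff.contDiffAt.comp z (hpow.comp z imCLM.contDiff.contDiffAt)

lemma contDiffOn_cauchyRiemann {M : ℂ → ℂ} {n m : WithTop ℕ∞}
    (hM : ContDiffOn ℝ n M {z : ℂ | 0 < z.im}) (hmn : m + 1 ≤ n) :
    ContDiffOn ℝ m (cauchyRiemann M) {z : ℂ | 0 < z.im} := by
  have h := hM.fderiv_of_isOpen isOpen_im_pos hmn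
  exact (h.clm_apply contDiffOn_const).add
    (contDiffOn_const.mul (h.clm_apply contDiffOn_const))

/-- The operator `ξ_k` on functions of a complex variable. -/
noncomputable def xiAux (k : ℤ) (M : ℂ → ℂ) (z : ℂ) : ℂ :=
  Complex.I * (((z.im ^ k : ℝ) : ℂ) * conj (cauchyRiemann M z))

lemma contDiffOn_xiAux (k : ℤ) {M : ℂ → ℂ} (hM : ContDiffOn ℝ 2 M {z : ℂ | 0 < z.im}) :
    ContDiffOn ℝ 1 (xiAux k M) {z : ℂ | 0 < z.im} := by
  have h := contDiffOn_cauchyRiemann (m := 1) hM (by norm_num)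
  exact contDiffOn_const.mul ((contDiffOn_im_zpow k).mul
    (conjCLE.toContinuousLinearMap.contDiff.comp_contDiffOn h))

lemma im_neg_one_div (z : ℂ) : (-1 / z).im = z.im / normSq z := by
  simp [neg_div]

lemma neg_one_div_im_pos {z : ℂ} (hz : 0 < z.im) : 0 < (-1 / z).im := by
  rw [im_neg_one_div]
  refine div_pos hz (normSq_pos.2 ?_)
  rintro rfl
  simp at hz

lemma cauchyRiemann_add_one {M : ℂ → ℂ} (hM : ContDiffOn ℝ 1 M {z : ℂ | 0 < z.im})
    (hper : ∀ z : ℂ, 0 < z.im → M (z + 1) = M z) {z : ℂ} (hz : 0 < z.im) :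
    cauchyRiemann M (z + 1) = cauchyRiemann M z := by
  have hz1 : 0 < (z + 1).im := by simpa using hz
  have h := cauchyRiemann_comp (σ := fun w ↦ w + 1)
    ((contDiffAt_of_im_pos hM hz1).differentiableAt one_ne_zero)
    (by fun_prop : DifferentiableAt ℂ (fun w ↦ w + 1) z)
  rw [cauchyRiemann_congr (v := M) (Filter.eventuallyEq_of_mem (isOpen_im_pos.mem_nhds hz) hper)] at h
  rw [h]
  simp

lemma cauchyRiemann_neg_one_div {k : ℤ} {M : ℂ → ℂ} (hM : ContDiffOn ℝ 1 M {z : ℂ | 0 < z.im})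
    (hS : ∀ z : ℂ, 0 < z.im → M (-1 / z) = z ^ k * M z) {z : ℂ} (hz : 0 < z.im) :
    cauchyRiemann M (-1 / z) = conj z ^ 2 * (z ^ k * cauchyRiemann M z) := by
  have hz0 : z ≠ 0 := by
    rintro rfl
    simp at hz
  have hd : HasDerivAt (fun w : ℂ ↦ -1 / w) (1 / z ^ 2) z := by
    simpa [div_eq_mul_inv] using (hasDerivAt_inv hz0).const_mul (-1)
  have h := cauchyRiemann_comp (σ := fun w ↦ -1 / w)
    ((contDiffAt_of_im_pos hM (neg_one_div_im_pos hz)).differentiableAt one_ne_zero)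
    hd.differentiableAt
  have hzk : DifferentiableAt ℂ (fun w : ℂ ↦ w ^ k) z := differentiableAt_zpow.2 (Or.inl hz0)
  rw [cauchyRiemann_congr (Filter.eventuallyEq_of_mem (isOpen_im_pos.mem_nhds hz) hS),
    cauchyRiemann_mul (hzk.restrictScalars ℝ)
      ((contDiffAt_of_im_pos hM hz).differentiableAt one_ne_zero),
    cauchyRiemann_of_differentiableAt hzk, hd.deriv] at h
  have hc : conj z ≠ 0 := by simpa using hz0
  rw [zero_mul, zero_add, map_div₀, map_one, map_pow] at h
  rw [h]
  field_simp

lemma xiAux_add_one (k : ℤ) {M : ℂ → ℂ} (hM : ContDiffOn ℝ 1 M {z : ℂ | 0 < z.im})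
    (hper : ∀ z : ℂ, 0 < z.im → M (z + 1) = M z) {z : ℂ} (hz : 0 < z.im) :
    xiAux k M (z + 1) = xiAux k M z := by
  simp [xiAux, cauchyRiemann_add_one hM hper hz]

/-- Conjugation turns the factor conj(z)² z^k of `cauchyRiemann_neg_one_div` into z² conj(z)^k, and
y^k contributes |z|^(-2k). What remains is z^(2-k). -/
lemma xiAux_neg_one_div {k : ℤ} {M : ℂ → ℂ} (hM : ContDiffOn ℝ 1 M {z : ℂ | 0 < z.im})
    (hS : ∀ z : ℂ, 0 < z.im → M (-1 / z) = z ^ k * M z) {z : ℂ} (hz : 0 < z.im) :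
    xiAux k M (-1 / z) = z ^ (2 - k) * xiAux k M z := by
  have hz0 : z ≠ 0 := by
    rintro rfl
    simp at hz
  have hc : conj z ≠ 0 := by simpa using hz0
  simp only [xiAux, cauchyRiemann_neg_one_div hM hS hz, im_neg_one_div, div_zpow]
  push_cast
  rw [← mul_conj, mul_zpow, zpow_sub₀ hz0]
  simp only [map_mul, map_pow, map_zpow₀, conj_conj]
  have h1 := zpow_ne_zero k hz0
  have h2 := zpow_ne_zero k hc
  field_simp

lemma fderiv_fderiv_apply {M : ℂ → ℂ} (hM : ContDiffOn ℝ 2 M {z : ℂ | 0 < z.im}) {z : ℂ}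
    (hz : 0 < z.im) (v w : ℂ) :
    fderiv ℝ (fun u ↦ fderiv ℝ M u v) z w = fderiv ℝ (fderiv ℝ M) z w v := by
  have hd : DifferentiableAt ℝ (fderiv ℝ M) z :=
    ((contDiffAt_of_im_pos hM hz).fderiv_right (m := 1) (by norm_num)).differentiableAt
      one_ne_zero
  rw [fderiv_clm_apply hd (differentiableAt_const v)]
  simp

/-- This is Δ_k = ξ_{2-k} ∘ ξ_k in first-order form. The second-order part comes from (∂x - i ∂y)(∂x
+ i ∂y) = ∂x² + ∂y², where the mixed terms cancel by symmetry of second derivatives. The first-order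
part comes from differentiating y^k. -/
lemma cauchyRiemann_xiAux (k : ℤ) {M : ℂ → ℂ} (hM : ContDiffOn ℝ 2 M {z : ℂ | 0 < z.im}) {z : ℂ}
    (hz : 0 < z.im) :
    cauchyRiemann (xiAux k M) z = Complex.I * (conj ((z.im : ℂ) ^ 2 *
      (fderiv ℝ (fun u ↦ fderiv ℝ M u 1) z 1 +
        fderiv ℝ (fun u ↦ fderiv ℝ M u Complex.I) z Complex.I) -
      Complex.I * k * z.im * cauchyRiemann M z) * (z.im : ℂ) ^ (k - 2)) := by
  have hd : DifferentiableAt ℝ (fderiv ℝ M) z :=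
    ((contDiffAt_of_im_pos hM hz).fderiv_right (m := 1) (by norm_num)).differentiableAt
      one_ne_zero
  have hsymm : fderiv ℝ (fderiv ℝ M) z 1 Complex.I = fderiv ℝ (fderiv ℝ M) z Complex.I 1 :=
    (contDiffAt_of_im_pos hM hz).isSymmSndFDerivAt (by simp) 1 Complex.I
  have hW : DifferentiableAt ℝ (cauchyRiemann M) z := (contDiffAt_of_im_pos
    (contDiffOn_cauchyRiemann (m := 1) hM (by norm_num)) hz).differentiableAt one_ne_zero
  have hWv : ∀ v, fderiv ℝ (cauchyRiemann M) z v =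
      fderiv ℝ (fderiv ℝ M) z v 1 + Complex.I * fderiv ℝ (fderiv ℝ M) z v Complex.I := by
    intro v
    have h1 : DifferentiableAt ℝ (fun u ↦ fderiv ℝ M u 1) z :=
      hd.clm_apply (differentiableAt_const _)
    have h2 : DifferentiableAt ℝ (fun u ↦ fderiv ℝ M u Complex.I) z :=
      hd.clm_apply (differentiableAt_const _)
    have : fderiv ℝ (cauchyRiemann M) z = _ := (h1.hasFDerivAt.add
      (h2.hasFDerivAt.const_mul Complex.I)).fderiv
    rw [this]
    simp only [add_apply, smul_apply, smul_eq_mul, fderiv_fderiv_apply hM hz]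
  have hWc : DifferentiableAt ℝ (fun w ↦ conj (cauchyRiemann M w)) z :=
    conjCLE.toContinuousLinearMap.differentiableAt.comp z hW
  have hIm := (hasFDerivAt_im_zpow k hz).differentiableAt
  have hprod := cauchyRiemann_mul (differentiableAt_const Complex.I) (hIm.mul hWc)
  have hconst : cauchyRiemann (fun _ ↦ Complex.I) z = 0 := by simp [cauchyRiemann]
  rw [hconst, zero_mul, zero_add] at hprod
  have hprod2 := cauchyRiemann_mul hIm hWc
  have hz' : (z.im : ℂ) ≠ 0 := by exact_mod_cast hz.ne'
  have e1 : (z.im : ℂ) ^ k = z.im ^ (k - 2) * z.im ^ 2 := by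
    rw [← zpow_natCast, ← zpow_add₀ hz']
    simp
  have e2 : (z.im : ℂ) ^ (k - 1) = z.im ^ (k - 2) * z.im := by
    rw [← zpow_add_one₀ hz']
    ring_nf
  refine hprod.trans ?_
  refine (congrArg (Complex.I * ·) hprod2).trans ?_
  simp only [fderiv_fderiv_apply hM hz]
  rw [cauchyRiemann_im_zpow k hz, cauchyRiemann_conj hW, hWv, hWv, hsymm]
  simp only [map_add, map_sub, map_mul, conj_I, map_pow, conj_ofReal, map_intCast]
  push_cast
  rw [e1, e2]
  linear_combination (-Complex.I) * z.im ^ (k - 2) * z.im ^ 2 *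
    conj (fderiv ℝ (fderiv ℝ M) z Complex.I Complex.I) * I_sq

/-! ### Growth estimates and the upper bound for the pairing. -/

lemma exists_forall_of_eventually_comap_im {p : ℂ → Prop}
    (h : ∀ᶠ z in comap Complex.im atTop, p z) (a : ℝ) :
    ∃ N ≥ a, ∀ z : ℂ, N ≤ z.im → p z := by
  obtain ⟨N, -, hN⟩ := (atTop_basis.comap Complex.im).eventually_iff.1 h
  exact ⟨max a N, le_max_left _ _, fun z hz ↦ hN ((le_max_right a N).trans hz)⟩

lemma tendsto_norm_mul_norm_mul_zpow {M G : ℂ → ℂ} {α c : ℝ} (hc : 0 < c)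
    (hM : M =O[comap Complex.im atTop] fun z ↦ z.im ^ α)
    (hG : G =O[comap Complex.im atTop] fun z ↦ Real.exp (-c * z.im)) (n : ℤ) :
    Tendsto (fun z : ℂ ↦ ‖M z‖ * ‖G z‖ * z.im ^ n) (comap Complex.im atTop) (𝓝 0) := by
  have h := ((hM.norm_left.mul hG.norm_left).mul
    (isBigO_refl (fun z : ℂ ↦ z.im ^ n) (comap Complex.im atTop)))
  refine h.trans_tendsto ?_
  have ht := (tendsto_rpow_mul_exp_neg_mul_atTop_nhds_zero (α + n) c hc).comp
    (tendsto_comap (f := Complex.im) (x := atTop))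
  refine ht.congr' ?_
  filter_upwards [preimage_mem_comap (Ioi_mem_atTop (0 : ℝ))] with z hz
  have hz' : 0 < z.im := hz
  simp only [Function.comp]
  rw [Real.rpow_add hz', Real.rpow_intCast]
  ring

/-- Cauchy's estimate on the unit disc about z: on it the imaginary part drops by at most 1, which
costs only a factor e^c. -/
lemma isBigO_deriv_exp {G : ℂ → ℂ} {c : ℝ} (hG : DifferentiableOn ℂ G {z : ℂ | 0 < z.im})
    (hGO : G =O[comap Complex.im atTop] fun z ↦ Real.exp (-c * z.im)) (hc : 0 < c) :
    deriv G =O[comap Complex.im atTop] fun z ↦ Real.exp (-c * z.im) := by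
  obtain ⟨C, hC0, hC⟩ := hGO.exists_nonneg
  obtain ⟨N, hN0, hN⟩ := exists_forall_of_eventually_comap_im hC.bound 0
  refine IsBigO.of_bound (C * Real.exp c) ?_
  filter_upwards [preimage_mem_comap (Ioi_mem_atTop (N + 1))] with z hz
  have hz' : N + 1 < z.im := hz
  have him : ∀ w ∈ Metric.closedBall z 1, z.im - 1 ≤ w.im := by
    intro w hw
    have h1 := (abs_im_le_norm (w - z)).trans (mem_closedBall_iff_norm.1 hw)
    rw [sub_im] at h1
    linarith [(abs_le.1 h1).1]
  have hd : DiffContOnCl ℂ G (Metric.ball z 1) := by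
    refine DifferentiableOn.diffContOnCl (hG.mono fun w hw ↦ ?_)
    rw [closure_ball z one_ne_zero] at hw
    have := him w hw
    show 0 < w.im
    linarith
  have := Complex.norm_deriv_le_of_forall_mem_sphere_norm_le one_pos hd
    (C := C * Real.exp c * Real.exp (-c * z.im)) fun w hw ↦ ?_
  · rwa [div_one, ← Real.norm_of_nonneg (Real.exp_nonneg (-c * z.im))] at this
  · have hw' := him w (Metric.sphere_subset_closedBall hw)
    refine (hN w (by linarith)).trans ?_
    rw [Real.norm_of_nonneg (Real.exp_nonneg _), mul_assoc, ← Real.exp_add]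
    gcongr
    nlinarith

lemma norm_integral_segment_le {φ : ℂ → ℂ} {ε T : ℝ}
    (h : ∀ z : ℂ, z.im = T → ‖φ z‖ ≤ ε) :
    ‖∫ x in (-1 / 2 : ℝ)..(1 / 2), φ (x + T * Complex.I)‖ ≤ ε := by
  have := intervalIntegral.norm_integral_le_of_norm_le_const (a := -1 / 2) (b := 1 / 2)
    (f := fun x : ℝ ↦ φ (x + T * Complex.I)) (C := ε) fun x _ ↦ h _ (by simp)
  refine this.trans (le_of_eq ?_)
  norm_num

lemma continuous_integral_clamped {φ : ℂ → ℂ} (hφ : ContinuousOn φ {z : ℂ | 0 < z.im}) (a b : ℝ) :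
    Continuous fun y : ℝ ↦ ∫ x in a..b, φ (x + (max y 1 : ℝ) * Complex.I) :=
  intervalIntegral.continuous_parametric_intervalIntegral_of_continuous'
    (f := fun y x : ℝ ↦ φ (x + (max y 1 : ℝ) * Complex.I))
    ((continuous_clamped hφ).comp continuous_swap) a b

lemma integral_rect_congr {φ ψ : ℂ → ℂ} {a b c d : ℝ} (hc : 0 < c) (hcd : c ≤ d)
    (h : ∀ z : ℂ, 0 < z.im → φ z = ψ z) :
    ∫ x in a..b, ∫ y in c..d, φ (x + y * Complex.I) =
      ∫ x in a..b, ∫ y in c..d, ψ (x + y * Complex.I) := by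
  refine intervalIntegral.integral_congr fun x _ ↦ intervalIntegral.integral_congr fun y hy ↦ ?_
  rw [uIcc_of_le hcd] at hy
  exact h _ (by simpa using hc.trans_le hy.1)

lemma integral_rect_sub {φ ψ : ℂ → ℂ} (hφ : ContinuousOn φ {z : ℂ | 0 < z.im})
    (hψ : ContinuousOn ψ {z : ℂ | 0 < z.im}) {a b c d : ℝ} (hc : 1 ≤ c) (hd : 1 ≤ d) :
    ∫ x in a..b, ∫ y in c..d, (φ (x + y * Complex.I) - ψ (x + y * Complex.I)) =
      (∫ x in a..b, ∫ y in c..d, φ (x + y * Complex.I)) -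
        ∫ x in a..b, ∫ y in c..d, ψ (x + y * Complex.I) := by
  have h := integral_rect_eq_clamped (fun z ↦ φ z - ψ z) (a := a) (b := b) hc hd
  rw [h, integral_rect_eq_clamped φ hc hd, integral_rect_eq_clamped ψ hc hd]
  have cφ := continuous_clamped hφ
  have cψ := continuous_clamped hψ
  rw [← intervalIntegral.integral_sub
    ((intervalIntegral.continuous_parametric_intervalIntegral_of_continuous' cφ c d).intervalIntegrable _ _)
    ((intervalIntegral.continuous_parametric_intervalIntegral_of_continuous' cψ c d).intervalIntegrable _ _)]
  refine intervalIntegral.integral_congr fun x _ ↦ ?_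
  exact intervalIntegral.integral_sub
    ((cφ.comp (by fun_prop : Continuous fun y : ℝ ↦ (x, y))).intervalIntegrable _ _)
    ((cψ.comp (by fun_prop : Continuous fun y : ℝ ↦ (x, y))).intervalIntegrable _ _)

/-- A lower bound for horizontal means passes to the integral over a strip of height one. -/
lemma le_re_integral_strip {φ : ℂ → ℂ} (hφ : ContinuousOn φ {z : ℂ | 0 < z.im}) {δ N : ℝ}
    (hN : 3 ≤ N) (hδ : ∀ T : ℝ, 3 ≤ T →
      δ ≤ (∫ x in (-1 / 2 : ℝ)..(1 / 2), φ (x + T * Complex.I)).re) :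
    δ ≤ (∫ x in (-1 / 2 : ℝ)..(1 / 2), ∫ y in N..N + 1, φ (x + y * Complex.I)).re := by
  rw [integral_rect_swap hφ (by norm_num) (by linarith) (by linarith)]
  have hcl : ∫ y in N..N + 1, ∫ x in (-1 / 2 : ℝ)..(1 / 2), φ (x + y * Complex.I) =
      ∫ y in N..N + 1, ∫ x in (-1 / 2 : ℝ)..(1 / 2), φ (x + (max y 1 : ℝ) * Complex.I) := by
    refine intervalIntegral.integral_congr fun y hy ↦ ?_
    rw [uIcc_of_le (by linarith)] at hy
    have : (1 : ℝ) ≤ y := by linarith [hy.1]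
    simp only [max_eq_left this]
  have hcont := continuous_integral_clamped hφ (-1 / 2) (1 / 2)
  have hre := reCLM.intervalIntegral_comp_comm (hcont.intervalIntegrable (μ := volume) N (N + 1))
  simp only [reCLM_apply] at hre
  rw [hcl, ← hre]
  have hconst : ∫ _ in N..N + 1, δ = δ := by simp
  rw [← hconst]
  refine intervalIntegral.integral_mono_on (by linarith) (by simp)
    ((continuous_re.comp hcont).intervalIntegrable _ _) fun y hy ↦ ?_
  have h3 : (3 : ℝ) ≤ y := by linarith [hy.1]
  rw [max_eq_left (by linarith)]
  exact hδ y h3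

lemma cauchyRiemann_conj_mul_im_zpow {G : ℂ → ℂ} (k : ℤ) {z : ℂ} (hz : 0 < z.im)
    (hG : DifferentiableAt ℂ G z) :
    cauchyRiemann (fun w ↦ conj (G w) * ((w.im ^ k : ℝ) : ℂ)) z =
      2 * conj (deriv G z) * ((z.im ^ k : ℝ) : ℂ) +
        conj (G z) * (Complex.I * ((k * z.im ^ (k - 1) : ℝ) : ℂ)) := by
  have hGr := hG.restrictScalars ℝ
  have hGc : DifferentiableAt ℝ (fun w ↦ conj (G w)) z :=
    conjCLE.toContinuousLinearMap.differentiableAt.comp z hGr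
  rw [cauchyRiemann_mul hGc (hasFDerivAt_im_zpow k hz).differentiableAt, cauchyRiemann_conj hGr,
    cauchyRiemann_im_zpow k hz, fderiv_real_apply hG, fderiv_real_apply hG]
  simp only [map_sub, map_mul, map_one, conj_I]
  linear_combination (-conj (deriv G z)) * ((z.im ^ k : ℝ) : ℂ) * I_sq

/-- Moderate growth of `M` and exponential decay of `G` make the pairing of `ξ_k M` with `G` small
on average, although no bound on the derivatives of `M` is assumed. -/
lemma exists_norm_integral_xiAux_mul_le {k : ℤ} {M G : ℂ → ℂ} {α c : ℝ} (hc : 0 < c)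
    (hM : ContDiffOn ℝ 2 M {z : ℂ | 0 < z.im})
    (hMper : ∀ z : ℂ, 0 < z.im → M (z + 1) = M z)
    (hG : DifferentiableOn ℂ G {z : ℂ | 0 < z.im})
    (hGper : ∀ z : ℂ, 0 < z.im → G (z + 1) = G z)
    (hMO : M =O[comap Complex.im atTop] fun z ↦ z.im ^ α)
    (hGO : G =O[comap Complex.im atTop] fun z ↦ Real.exp (-c * z.im)) {ε : ℝ} (hε : 0 < ε) :
    ∃ N ≥ (3 : ℝ), ‖∫ x in (-1 / 2 : ℝ)..(1 / 2), ∫ y in N..N + 1,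
      xiAux k M (x + y * Complex.I) * G (x + y * Complex.I)‖ ≤ ε := by
  set E : ℂ → ℂ := fun w ↦ conj (G w) * ((w.im ^ k : ℝ) : ℂ) with hE
  have hEs : ContDiffOn ℝ 2 E {z : ℂ | 0 < z.im} :=
    (conjCLE.toContinuousLinearMap.contDiff.comp_contDiffOn
      (contDiffOn_real_of_differentiableOn hG)).mul (contDiffOn_im_zpow k)
  have hE1 := hEs.of_le (m := 1) (by norm_num)
  have hM1 := hM.of_le (m := 1) (by norm_num)
  have hP1 : ContDiffOn ℝ 1 (fun z ↦ M z * E z) {z : ℂ | 0 < z.im} := hM1.mul hE1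
  have hPper : ∀ z : ℂ, 0 < z.im → M (z + 1) * E (z + 1) = M z * E z := by
    intro z hz
    simp [hE, hMper z hz, hGper z hz]
  have hR : ContinuousOn (fun z ↦ M z * cauchyRiemann E z) {z : ℂ | 0 < z.im} :=
    hM1.continuousOn.mul (continuousOn_cauchyRiemann hE1)
  -- Integration by parts in pointwise form: the left side is i times the conjugate of (∂x + i ∂y)M
  -- · E, and the product rule moves the derivative to E.
  have hdecomp : ∀ z : ℂ, 0 < z.im → xiAux k M z * G z =
      Complex.I * conj (cauchyRiemann (fun z ↦ M z * E z) z - M z * cauchyRiemann E z) := by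
    intro z hz
    rw [cauchyRiemann_mul ((contDiffAt_of_im_pos hM1 hz).differentiableAt one_ne_zero)
      ((contDiffAt_of_im_pos hE1 hz).differentiableAt one_ne_zero)]
    simp only [add_sub_cancel_right, hE, xiAux, map_mul, conj_conj, conj_ofReal]
    ring
  have hlimP := tendsto_norm_mul_norm_mul_zpow hc hMO hGO k
  have hlimR := ((tendsto_norm_mul_norm_mul_zpow hc hMO (isBigO_deriv_exp hG hGO hc) k).const_mul
    2).add ((tendsto_norm_mul_norm_mul_zpow hc hMO hGO (k - 1)).const_mul |(k : ℝ)|)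
  simp only [mul_zero, add_zero] at hlimR
  -- One third each for the top edge, the bottom edge and the remaining integral over the strip,
  -- which has area one.
  have hε3 : 0 < ε / 3 := by positivity
  obtain ⟨N, hN3, hN⟩ := exists_forall_of_eventually_comap_im
    ((hlimP.eventually (ge_mem_nhds hε3)).and (hlimR.eventually (ge_mem_nhds hε3))) 3
  have hbP : ∀ z : ℂ, N ≤ z.im → ‖M z * E z‖ ≤ ε / 3 := by
    intro z hz
    have hz0 : 0 < z.im := by linarith
    refine le_of_eq_of_le ?_ (hN z hz).1
    simp only [hE, norm_mul, RCLike.norm_conj, norm_real, Real.norm_eq_abs,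
      abs_of_pos (zpow_pos hz0 k)]
    ring
  have hbR : ∀ z : ℂ, N ≤ z.im → ‖M z * cauchyRiemann E z‖ ≤ ε / 3 := by
    intro z hz
    have hz0 : 0 < z.im := by linarith
    refine le_trans ?_ (hN z hz).2
    rw [hE, cauchyRiemann_conj_mul_im_zpow k hz0 (hG.differentiableAt (isOpen_im_pos.mem_nhds hz0)),
      mul_add]
    refine (norm_add_le _ _).trans (le_of_eq ?_)
    simp only [norm_mul, RCLike.norm_conj, norm_real, Real.norm_eq_abs, norm_I, norm_ofNat,
      abs_of_pos (zpow_pos hz0 k), abs_of_pos (zpow_pos hz0 (k - 1))]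
    ring
  refine ⟨N, hN3, ?_⟩
  rw [integral_rect_congr (by linarith) (by linarith) hdecomp]
  have hconj : ∀ (u : ℝ → ℂ) (a b : ℝ), ∫ t in a..b, conj (u t) = conj (∫ t in a..b, u t) := by
    intro u a b
    simp only [intervalIntegral, integral_conj, map_sub]
  simp only [intervalIntegral.integral_const_mul, hconj]
  rw [norm_mul, norm_I, one_mul, RCLike.norm_conj,
    integral_rect_sub (continuousOn_cauchyRiemann hP1) hR (by linarith) (by linarith),
    integral_cauchyRiemann_strip hP1 hPper (by linarith) (by linarith)]
  have h1 := norm_integral_segment_le (φ := fun z ↦ M z * E z) (T := N)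
    fun z hz ↦ hbP z hz.ge
  have h2 := norm_integral_segment_le (φ := fun z ↦ M z * E z) (T := N + 1)
    fun z hz ↦ hbP z (by linarith)
  have h3 : ‖∫ x in (-1 / 2 : ℝ)..(1 / 2), ∫ y in N..N + 1,
      M (x + y * Complex.I) * cauchyRiemann E (x + y * Complex.I)‖ ≤ ε / 3 := by
    have hin : ∀ x : ℝ, ‖∫ y in N..N + 1,
        M (x + y * Complex.I) * cauchyRiemann E (x + y * Complex.I)‖ ≤ ε / 3 := by
      intro x
      have := intervalIntegral.norm_integral_le_of_norm_le_const (a := N) (b := N + 1)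
        (f := fun y : ℝ ↦ M (x + y * Complex.I) * cauchyRiemann E (x + y * Complex.I))
        (C := ε / 3) fun y hy ↦ by
          rw [uIoc_of_le (by linarith)] at hy
          exact hbR _ (by simpa using hy.1.le)
      simpa using this
    have := intervalIntegral.norm_integral_le_of_norm_le_const (a := -1 / 2) (b := 1 / 2)
      (f := fun x : ℝ ↦ ∫ y in N..N + 1,
        M (x + y * Complex.I) * cauchyRiemann E (x + y * Complex.I))
      (C := ε / 3) fun x _ ↦ hin x
    refine this.trans (le_of_eq ?_)
    norm_num
  refine (norm_sub_le _ _).trans ?_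
  rw [norm_mul, norm_I, one_mul]
  have := norm_sub_le (∫ x in (-1 / 2 : ℝ)..(1 / 2), M (x + (N + 1 : ℝ) * Complex.I) *
    E (x + (N + 1 : ℝ) * Complex.I)) (∫ x in (-1 / 2 : ℝ)..(1 / 2), M (x + N * Complex.I) *
    E (x + N * Complex.I))
  linarith

/-! ### Translation from ℍ to functions of a complex variable. -/

lemma comp_ofComplex_neg_one_div {k : ℤ} {f : ℍ → ℂ} (hf : f ∣[k] ModularGroup.S = f) {z : ℂ}
    (hz : 0 < z.im) : (f ∘ ofComplex) (-1 / z) = z ^ k * (f ∘ ofComplex) z := by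
  have hz0 : z ≠ 0 := by
    rintro rfl
    simp at hz
  have h := congrFun hf ⟨z, hz⟩
  rw [SlashInvariantForm.slash_S_apply] at h
  simp only [Function.comp, ofComplex_apply_of_im_pos hz,
    ofComplex_apply_of_im_pos (neg_one_div_im_pos hz)]
  rw [← h, mul_left_comm, ← zpow_add₀ hz0, add_neg_cancel, zpow_zero, mul_one]
  congr 1
  ext
  simp [neg_div, inv_neg]

lemma comp_ofComplex_add_one {k : ℤ} {f : ℍ → ℂ} (hf : f ∣[k] ModularGroup.T = f) {z : ℂ}
    (hz : 0 < z.im) : (f ∘ ofComplex) (z + 1) = (f ∘ ofComplex) z := by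
  have hz1 : 0 < (z + 1).im := by simpa using hz
  have h := congrFun hf ⟨z, hz⟩
  rw [ModularForm.SL_slash_apply, modular_T_smul] at h
  simp only [Function.comp, ofComplex_apply_of_im_pos hz, ofComplex_apply_of_im_pos hz1]
  have hd : denom (Matrix.SpecialLinearGroup.toGL ((Matrix.SpecialLinearGroup.map
      (Int.castRingHom ℝ)) ModularGroup.T)) z = 1 := by
    simp [denom, ModularGroup.coe_T]
  have hT : (1 : ℝ) +ᵥ (⟨z, hz⟩ : ℍ) = ⟨z + 1, hz1⟩ := by
    ext
    simp [add_comm]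
  rwa [hT, hd, one_zpow, mul_one] at h

lemma isBigO_comp_ofComplex {f : ℍ → ℂ} {u : ℝ → ℝ} (hf : f =O[atImInfty] fun z ↦ u z.im) :
    (f ∘ ofComplex) =O[comap Complex.im atTop] fun z ↦ u z.im := by
  refine (hf.comp_tendsto tendsto_comap_im_ofComplex).congr' EventuallyEq.rfl ?_
  filter_upwards [preimage_mem_comap (Ioi_mem_atTop (0 : ℝ))] with z hz
  simp [ofComplex_apply_of_im_pos (show 0 < z.im from hz)]

lemma dbar_eq_cauchyRiemann (f : ℍ → ℂ) (z : ℍ) :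
    dbar f z = 1 / 2 * cauchyRiemann (f ∘ ofComplex) z := rfl

/-- Solving ξ_{2-k} f = g for ∂f/∂z̄ gives the same first-order equation that ξ_k M satisfies when
Δ_k M = g. -/
lemma cauchyRiemann_of_xi_eq {k : ℤ} {f g : ℍ → ℂ} (h : xi (2 - k) f = g) {z : ℂ}
    (hz : 0 < z.im) : cauchyRiemann (f ∘ ofComplex) z =
      Complex.I * (conj ((g ∘ ofComplex) z) * (z.im : ℂ) ^ (k - 2)) := by
  have h1 := congrFun h ⟨z, hz⟩
  have hz' : (z.im : ℂ) ≠ 0 := by exact_mod_cast hz.ne'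
  simp only [xi, dbar_eq_cauchyRiemann] at h1
  rw [show (⟨z, hz⟩ : ℍ).im = z.im from rfl] at h1
  simp only [Function.comp, ofComplex_apply_of_im_pos hz, ← h1]
  simp only [map_mul, map_div₀, map_zpow₀, conj_conj, conj_I, conj_ofReal, map_ofNat, map_one]
  have e : (z.im : ℂ) ^ (2 - k) * (z.im : ℂ) ^ (k - 2) = 1 := by
    rw [← zpow_add₀ hz']
    simp
  have e' : cauchyRiemann (f ∘ ofComplex) z =
    cauchyRiemann (f ∘ ofComplex) ((⟨z, hz⟩ : ℍ) : ℂ) := rfl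
  linear_combination e' + cauchyRiemann (f ∘ ofComplex) ((⟨z, hz⟩ : ℍ) : ℂ) *
    (Complex.I ^ 2 * e + I_sq)

/-- The two functions being differentiated agree near z, since `ofComplex` inverts the coercion on
the open half-plane. This is what iterating `partialX` and `partialY` requires. -/
lemma fderiv_comp_ofComplex_fderiv (F : ℂ → ℂ) (v w : ℂ) (z : ℍ) :
    fderiv ℝ ((fun u : ℍ ↦ fderiv ℝ F (u : ℂ) v) ∘ ofComplex) z w =
      fderiv ℝ (fun u ↦ fderiv ℝ F u v) z w := by
  refine congrArg (fun L : ℂ →L[ℝ] ℂ ↦ L w) (Filter.EventuallyEq.fderiv_eq ?_)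
  filter_upwards [isOpen_im_pos.mem_nhds z.im_pos] with u hu
  simp [ofComplex_apply_of_im_pos hu]

lemma hypLaplacian_eq (k : ℤ) (f : ℍ → ℂ) (z : ℍ) : hypLaplacian k f z =
    ((z : ℂ).im : ℂ) ^ 2 * (fderiv ℝ (fun u ↦ fderiv ℝ (f ∘ ofComplex) u 1) z 1 +
        fderiv ℝ (fun u ↦ fderiv ℝ (f ∘ ofComplex) u Complex.I) z Complex.I) -
      Complex.I * k * (z : ℂ).im * cauchyRiemann (f ∘ ofComplex) z := by
  rw [← fderiv_comp_ofComplex_fderiv, ← fderiv_comp_ofComplex_fderiv]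
  rfl

/-- The common core of both parts, applied with F = ξ_k M and with F = f. -/
lemma exists_re_integral_comp_ofComplex_mul_ge {k : ℤ} (g : CuspForm 𝒮ℒ k) (hg : g ≠ 0) {F : ℂ → ℂ}
    (hF : ContDiffOn ℝ 1 F {z : ℂ | 0 < z.im})
    (hFper : ∀ z : ℂ, 0 < z.im → F (z + 1) = F z)
    (hFS : ∀ z : ℂ, 0 < z.im → F (-1 / z) = z ^ (2 - k) * F z)
    (hcr : ∀ z : ℂ, 0 < z.im → cauchyRiemann F z =
      Complex.I * (conj ((g ∘ ofComplex) z) * (z.im : ℂ) ^ (k - 2))) :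
    ∃ δ > 0, ∀ T : ℝ, 3 ≤ T → δ ≤ (∫ x in (-1 / 2 : ℝ)..(1 / 2),
      F (x + T * Complex.I) * (g ∘ ofComplex) (x + T * Complex.I)).re := by
  have hslash : ∀ γ : SL(2, ℤ), ⇑g ∣[k] γ = ⇑g := fun γ ↦
    SlashInvariantForm.slash_action_eqn g _ ⟨γ, rfl⟩
  refine exists_re_integral_mul_ge hF hFper hFS
    (mdifferentiable_iff.1 g.holo') (fun z hz ↦ comp_ofComplex_add_one (hslash _) hz)
    (fun z hz ↦ comp_ofComplex_neg_one_div (hslash _) hz) hcr ?_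
  by_contra! hcon
  refine hg (DFunLike.ext _ _ fun z ↦ ?_)
  simpa using hcon z z.im_pos

end PolyMaass

/-! ### The two contradictions. -/

theorem mainTheorem7 (k : ℤ) (g : CuspForm 𝒮ℒ k) (hg : g ≠ 0) :
    (∀ M : ℍ → ℂ, PolyMaass.IsSmoothModularForm k M →
      PolyMaass.hypLaplacian k M = ⇑g → ¬ PolyMaass.HasModerateGrowth M) ∧
    (¬ ∃ f ∈ PolyMaass.polyharmonicMaassForms (2 - k) 1, PolyMaass.xi (2 - k) f = ⇑g) := by
  have hslash : ∀ γ : SL(2, ℤ), ⇑g ∣[k] γ = ⇑g := fun γ ↦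
    SlashInvariantForm.slash_action_eqn g _ ⟨γ, rfl⟩
  have hGd : DifferentiableOn ℂ (g ∘ ofComplex) {z : ℂ | 0 < z.im} := mdifferentiable_iff.1 g.holo'
  obtain ⟨c, hc, hgO⟩ := CuspFormClass.exp_decay_atImInfty' g
  have hGO := PolyMaass.isBigO_comp_ofComplex (u := fun y ↦ Real.exp (-c * y)) hgO
  refine ⟨fun M hM hΔ ⟨α, hα⟩ ↦ ?_, ?_⟩
  · have hMO := PolyMaass.isBigO_comp_ofComplex (u := fun y ↦ y ^ α) hα
    have hM2 : ContDiffOn ℝ 2 (M ∘ ofComplex) {z : ℂ | 0 < z.im} :=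
      hM.smooth.of_le (by simpa using (WithTop.coe_le_coe.2 (le_top : (2 : ℕ∞) ≤ ⊤)))
    have hM1 := hM2.of_le (m := 1) (by norm_num)
    have hMper : ∀ z : ℂ, 0 < z.im → (M ∘ ofComplex) (z + 1) = (M ∘ ofComplex) z := fun z hz ↦
      PolyMaass.comp_ofComplex_add_one (hM.slash_eq _) hz
    have hξ := PolyMaass.contDiffOn_xiAux k hM2
    obtain ⟨δ, hδ0, hδ⟩ := PolyMaass.exists_re_integral_comp_ofComplex_mul_ge g hg hξ
      (fun z hz ↦ PolyMaass.xiAux_add_one k hM1 hMper hz)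
      (fun z hz ↦ PolyMaass.xiAux_neg_one_div hM1
        (fun z hz ↦ PolyMaass.comp_ofComplex_neg_one_div (hM.slash_eq _) hz) hz)
      (fun z hz ↦ by
        rw [PolyMaass.cauchyRiemann_xiAux k hM2 hz, Function.comp_apply,
          ofComplex_apply_of_im_pos hz, ← hΔ, PolyMaass.hypLaplacian_eq])
    -- On this strip the average has norm at most δ/2, whereas every horizontal mean has real part
    -- at least δ.
    obtain ⟨N, hN, hle⟩ := PolyMaass.exists_norm_integral_xiAux_mul_le (k := k) hc hM2 hMper hGd
      (fun z hz ↦ PolyMaass.comp_ofComplex_add_one (hslash _) hz) hMO hGO (half_pos hδ0)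
    have hge := PolyMaass.le_re_integral_strip
      (φ := fun z ↦ PolyMaass.xiAux k (M ∘ ofComplex) z * (g ∘ ofComplex) z)
      (hξ.continuousOn.mul hGd.continuousOn) hN hδ
    linarith [Complex.re_le_norm (∫ x in (-1 / 2 : ℝ)..(1 / 2), ∫ y in N..N + 1,
      PolyMaass.xiAux k (M ∘ ofComplex) (x + y * Complex.I) *
        (g ∘ ofComplex) (x + y * Complex.I))]
  · rintro ⟨f, ⟨hf, -, α, hα⟩, hξ⟩
    have hfO := PolyMaass.isBigO_comp_ofComplex (u := fun y ↦ y ^ α) hα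
    obtain ⟨δ, hδ0, hδ⟩ := PolyMaass.exists_re_integral_comp_ofComplex_mul_ge g hg
      (hf.smooth.of_le (by exact_mod_cast le_top))
      (fun z hz ↦ PolyMaass.comp_ofComplex_add_one (hf.slash_eq _) hz)
      (fun z hz ↦ PolyMaass.comp_ofComplex_neg_one_div (hf.slash_eq _) hz)
      (fun z hz ↦ PolyMaass.cauchyRiemann_of_xi_eq hξ hz)
    -- With exponent 0 this says f g → 0 at the cusp, so a single horizontal line suffices and no
    -- averaging is needed.
    have hlim := PolyMaass.tendsto_norm_mul_norm_mul_zpow hc hfO hGO 0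
    obtain ⟨N, hN3, hN⟩ := PolyMaass.exists_forall_of_eventually_comap_im
      (hlim.eventually (ge_mem_nhds (half_pos hδ0))) 3
    have hle := PolyMaass.norm_integral_segment_le (T := N)
      (φ := fun z ↦ (f ∘ ofComplex) z * (g ∘ ofComplex) z) (ε := δ / 2) fun z hz ↦ by
        simpa using hN z hz.ge
    linarith [hδ N hN3, Complex.re_le_norm (∫ x in (-1 / 2 : ℝ)..(1 / 2),
      (f ∘ ofComplex) (x + N * Complex.I) * (g ∘ ofComplex) (x + N * Complex.I))]
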